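/- Let $\Gamma=(I,E,m)$ be a finite simplicial graph with vertex set $I$ and edge set $E$, whose edges are labelled by a map $m:E\to\mathbb{N}_{\ge 2}$. The associated Artin-Tits group $A_I$ is the group with generators $\Sigma_I=\{\sigma_i\mid i\in I\}$ and relations $\sigma_i\sigma_j\sigma_i\cdots=\sigma_j\sigma_i\sigma_j\cdots$ ($m(\{i,j\})$ factors on each side), one for each edge $\{i,j\}\in E$; let $A_I^+$ be the submonoid of $A_I$ generated by $\Sigma_I$. For $X\subseteq I$ put $\Sigma_X=\{\sigma_i\mid i\in X\}$, let $A_X$ and $A_X^+$ be the Artin-Tits group and its submonoid defined in the same way from the full labelled subgraph $\Gamma_X$ of $\Gamma$ spanned by $X$, and let $\iota_X:A_X\to A_I$ be the morphism with $\sigma_i\mapsto\sigma_i$ for $i\in X$. Let $X\subseteq I$. Then: (i) If two words on $\Sigma_X\cup\Sigma_X^{-1}$ represent the same element of $A_I$, then they represent the same element of $A_X$. In particular, $\iota_X$ is injective, so that one can identify $A_X$ with its image in $A_I$. (ii) If $Y$ is another subset of $I$, then $A_X\cap A_Y=A_{X\cap Y}$ in $A_I$. (iii) $A_X^+=A_I^+\cap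 A_X$ in $A_I$. (iv) The subgroup $A_X$ is convex: if an element of $A_I$ lies in $A_X$, then each of its representative words of minimal length on $\Sigma_I\cup\Sigma_I^{-1}$ is a word on $\Sigma_X\cup\Sigma_X^{-1}$. -/

import Mathlib

/-- A simplicial graph with vertex set `I` whose edges are labelled by integers `≥ 2`. -/
structure LabelledGraph (I : Type*) where
  /-- The underlying simplicial graph. -/
  graph : SimpleGraph I
  /-- The label map, defined on the edges. -/
  label : graph.edgeSet → ℕ
  two_le_label : ∀ e, 2 ≤ label e

namespace LabelledGraph

/-- The full labelled subgraph `Γ_X` spanned by a set `X` of vertices. -/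
def full {I : Type*} (Γ : LabelledGraph I) (X : Set I) : LabelledGraph X where
  graph := Γ.graph.induce X
  label e := Γ.label ((SimpleGraph.Embedding.induce X).toHom.mapEdgeSet e)
  two_le_label _ := Γ.two_le_label _

/-- The label `m(i,j)` of an edge `{i,j}`. -/
def m {I : Type*} (Γ : LabelledGraph I) {i j : I} (h : Γ.graph.Adj i j) : ℕ :=
  Γ.label ⟨s(i, j), h⟩

theorem m_full {I : Type*} (Γ : LabelledGraph I) (X : Set I) {i j : X}
    (h : (Γ.full X).graph.Adj i j) :
    (Γ.full X).m h = Γ.m (i := (i : I)) (j := (j : I)) h := rfl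

end LabelledGraph

namespace ArtinTits

/-- The alternating product `a * b * a * ⋯` with `n` factors, starting with `a`. -/
def altProd {G : Type*} [Group G] (a b : G) : ℕ → G
  | 0 => 1
  | n + 1 => a * altProd b a n

theorem map_altProd {G H : Type*} [Group G] [Group H] (f : G →* H) (a b : G) (n : ℕ) :
    f (altProd a b n) = altProd (f a) (f b) n := by
  induction n generalizing a b with
  | zero => simp [altProd]
  | succ n ih => simp [altProd, ih]

/-- The braid relators `(σᵢσⱼσᵢ⋯)(σⱼσᵢσⱼ⋯)⁻¹`, with `m(i,j)` factors on either side,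
for the edges `{i,j}` of `Γ`. -/
def braidRelators {I : Type*} (Γ : LabelledGraph I) : Set (FreeGroup I) :=
  {r | ∃ (i j : I) (h : Γ.graph.Adj i j),
    r = altProd (FreeGroup.of i) (FreeGroup.of j) (Γ.m h) *
      (altProd (FreeGroup.of j) (FreeGroup.of i) (Γ.m h))⁻¹}

/-- The Artin-Tits group associated with `Γ`. -/
abbrev ArtinGroup {I : Type*} (Γ : LabelledGraph I) : Type _ :=
  PresentedGroup (braidRelators Γ)

/-- The standard generator `σᵢ`. -/
def sigma {I : Type*} (Γ : LabelledGraph I) (i : I) : ArtinGroup Γ :=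
  PresentedGroup.of i

theorem sigma_braid {I : Type*} (Γ : LabelledGraph I) {i j : I} (h : Γ.graph.Adj i j) :
    altProd (sigma Γ i) (sigma Γ j) (Γ.m h) = altProd (sigma Γ j) (sigma Γ i) (Γ.m h) := by
  have hr := PresentedGroup.one_of_mem (rels := braidRelators Γ) ⟨i, j, h, rfl⟩
  rw [map_mul, map_inv, mul_inv_eq_one, map_altProd, map_altProd] at hr
  exact hr

/-- The natural morphism `ι_X : A_X → A_I` that sends `σᵢ` to `σᵢ` for `i ∈ X`. -/
def inclusion {I : Type*} (Γ : LabelledGraph I) (X : Set I) :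
    ArtinGroup (Γ.full X) →* ArtinGroup Γ :=
  PresentedGroup.toGroup (f := fun i : X => sigma Γ (i : I)) (by
    rintro _ ⟨i, j, h, rfl⟩
    rw [map_mul, map_inv, mul_inv_eq_one, map_altProd, map_altProd, FreeGroup.lift_apply_of,
      FreeGroup.lift_apply_of, LabelledGraph.m_full]
    exact sigma_braid Γ (i := (i : I)) (j := (j : I)) h)

/-- The submonoid `A⁺` of the Artin-Tits group that is generated by the `σᵢ`. -/
def positive {I : Type*} (Γ : LabelledGraph I) : Submonoid (ArtinGroup Γ) :=
  Submonoid.closure (Set.range (sigma Γ))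

/-- Words on the formal letters `σᵢ` (the pair `(i, true)`) and `σᵢ⁻¹` (the pair `(i, false)`),
not necessarily freely reduced. -/
abbrev SignedWord (I : Type*) : Type _ := List (I × Bool)

/-- The element of the Artin-Tits group represented by a word. -/
def wordVal {I : Type*} (Γ : LabelledGraph I) (w : SignedWord I) : ArtinGroup Γ :=
  (w.map fun p => if p.2 then sigma Γ p.1 else (sigma Γ p.1)⁻¹).prod

/-- A word on `Σ_X ∪ Σ_X⁻¹`, seen as a word on `Σ_I ∪ Σ_I⁻¹`. -/
def SignedWord.incl {I : Type*} {X : Set I} (w : SignedWord X) : SignedWord I :=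
  w.map fun p => ((p.1 : I), p.2)

end ArtinTits

/-!
The four claims follow from a set-theoretic retraction `π : A_I → A_X` that maps positive elements
to positive elements and that acts on words letter by letter, each letter being kept (up to a
relabelling by `X`) or deleted, where some letter is deleted if the word has a letter outside of
`X`. Such a map yields injectivity of `ι_X` (`ArtinTits.retraction_inclusion`), the claim on
positive elements (`ArtinTits.retraction_mem_positive`), and convexity, since a deleted letter would
shorten a minimal word (`ArtinTits.exists_word_retraction`, `ArtinTits.mem_of_minimal_length`). A
minimal word of an element of `A_X ∩ A_Y` then is a word on `X ∩ Y`.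

The retraction comes from an action of `A_I` on the set of pairs `(c, a)`, where `c` is a coset in
`W / W_X`, for `W` the Coxeter group of `Γ`, and `a ∈ A_X`. A coset is given by its minimal
representative `c`. If `sᵢ c = c sₓ` for some `x ∈ X`, then `σᵢ (c, a) = (c, σₓ a)`; otherwise
`sᵢ c` is again minimal and `σᵢ (c, a) = (sᵢ c, a)`. The value `π g` is the second
component of `g (1, 1)`.

The point is that the braid relations hold (`CoxeterMatrix.MinRep.altProd_step_comm`). The orbit of
`c` under two generators `sᵢ`, `sⱼ` has a bottom `c₀`, without left descent `sᵢ` or `sⱼ`. If neither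
generator fixes the coset of `c₀`, the orbit is free. If both do, it is a point, and the relation is
one of `A_X`, with the same label as the geometric representation preserves the bilinear form. If
one does, the orbit is a path with a loop at both ends, both labelled by the same `x`, and either
side of the braid relation traverses exactly one of the loops (`CoxeterMatrix.altEnd_line`).

Minimal representatives are handled through the geometric representation of `W` on `I →₀ ℝ`: `c` is
minimal if `c eₓ` is positive for all `x ∈ X`, and `sᵢ c = c sₓ` is expressed as `c eₓ = eᵢ`. What
makes this work is that every root is positive or negative
(`CoxeterMatrix.geomRep_root_nonneg`).
-/

/-! ### Alternating products -/

namespace ArtinTits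

/-- The alternating product `⋯ * a * b * a` with `n` factors, ending with `a`. -/
def altEnd {G : Type*} [Group G] (a b : G) : ℕ → G
  | 0 => 1
  | n + 1 => altEnd b a n * a

theorem map_altEnd {G H : Type*} [Group G] [Group H] (f : G →* H) (a b : G) (n : ℕ) :
    f (altEnd a b n) = altEnd (f a) (f b) n := by
  induction n generalizing a b with
  | zero => simp [altEnd]
  | succ n ih => simp [altEnd, ih]

theorem altEnd_succ' {G : Type*} [Group G] (a b : G) (n : ℕ) :
    altEnd a b (n + 1) = (if Even n then a else b) * altEnd a b n := by
  induction n generalizing a b with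
  | zero => simp [altEnd]
  | succ n ih =>
    rw [altEnd, ih, altEnd, mul_assoc]
    simp only [Nat.even_add_one]
    split_ifs <;> rfl

theorem altEnd_add {G : Type*} [Group G] (a b : G) (n m : ℕ) :
    altEnd a b (n + m) = (if Even m then altEnd a b n else altEnd b a n) * altEnd a b m := by
  induction m generalizing a b with
  | zero => simp [altEnd]
  | succ m ih =>
    rw [← add_assoc, altEnd, ih, altEnd, mul_assoc]
    simp only [Nat.even_add_one]
    split_ifs <;> rfl

theorem altEnd_eq_altProd {G : Type*} [Group G] (a b : G) (n : ℕ) :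
    altEnd a b n = if Even n then altProd b a n else altProd a b n := by
  induction n with
  | zero => simp [altEnd, altProd]
  | succ n ih =>
    rw [altEnd_succ', ih]
    simp only [Nat.even_add_one]
    split_ifs <;> simp_all [altProd]

theorem altEnd_comm_iff {G : Type*} [Group G] (a b : G) (n : ℕ) :
    altEnd a b n = altEnd b a n ↔ altProd a b n = altProd b a n := by
  rw [altEnd_eq_altProd, altEnd_eq_altProd]
  split_ifs
  · exact eq_comm
  · rfl

theorem altProd_inv {G : Type*} [Group G] {a b : G} (ha : a⁻¹ = a) (hb : b⁻¹ = b) (n : ℕ) :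
    (altProd a b n)⁻¹ = altEnd a b n := by
  induction n generalizing a b with
  | zero => simp [altEnd, altProd]
  | succ n ih => rw [altProd, altEnd, mul_inv_rev, ih hb ha, ha]

theorem altProd_mul_inv {G : Type*} [Group G] {a b : G} (ha : a⁻¹ = a) (hb : b⁻¹ = b) (n : ℕ) :
    altProd a b n * (altProd b a n)⁻¹ = (a * b) ^ n := by
  induction n generalizing a b with
  | zero => simp [altProd]
  | succ n ih =>
    have h := ih hb ha
    calc altProd a b (n + 1) * (altProd b a (n + 1))⁻¹
        = a * (altProd b a n * (altProd a b n)⁻¹) * b⁻¹ := by simp only [altProd]; group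
      _ = a * (b * a) ^ n * b := by rw [h, hb]
      _ = (a * b) ^ (n + 1) := by rw [← mul_pow_mul, mul_assoc, ← pow_succ]

theorem altProd_comm_iff {G : Type*} [Group G] {a b : G} (ha : a⁻¹ = a) (hb : b⁻¹ = b) (n : ℕ) :
    altProd a b n = altProd b a n ↔ (a * b) ^ n = 1 := by
  rw [← altProd_mul_inv ha hb, mul_inv_eq_one]

end ArtinTits

namespace CoxeterMatrix

open Real ArtinTits

/-! ### Roots of dihedral groups -/

/-- The coefficients `a₀, a₁, a₂, …` of the roots of the dihedral group of order `2m` in the basis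
of simple roots. They satisfy `a₀ = 0`, `a₁ = 1`, `aₙ₊₂ = 2 cos (π / m) aₙ₊₁ - aₙ`, and `m = 0`
stands for the infinite dihedral group. -/
noncomputable def dihedralCoeff (m n : ℕ) : ℝ :=
  if m = 0 then n else sin (n * (π / m)) / sin (π / m)

theorem sin_pi_div_pos {m : ℕ} (hm : 2 ≤ m) : 0 < sin (π / m) := by
  have h2 : (2 : ℝ) ≤ m := by exact_mod_cast hm
  apply sin_pos_of_pos_of_lt_pi (by positivity)
  rw [div_lt_iff₀ (by linarith)]
  nlinarith [pi_pos]

theorem dihedralCoeff_zero (m : ℕ) : dihedralCoeff m 0 = 0 := by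
  simp [dihedralCoeff]

theorem dihedralCoeff_one {m : ℕ} (hm : m ≠ 1) : dihedralCoeff m 1 = 1 := by
  rcases eq_or_ne m 0 with rfl | h
  · simp [dihedralCoeff]
  · have := (sin_pi_div_pos (m := m) (by lia)).ne'
    simp [dihedralCoeff, h, this]

theorem dihedralCoeff_add_two {m : ℕ} (hm : m ≠ 1) (n : ℕ) :
    dihedralCoeff m (n + 2) =
      2 * cos (π / m) * dihedralCoeff m (n + 1) - dihedralCoeff m n := by
  rcases eq_or_ne m 0 with rfl | h
  · simp [dihedralCoeff]; ring
  · have h0 := (sin_pi_div_pos (m := m) (by lia)).ne'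
    simp only [dihedralCoeff, h, if_false]
    push_cast
    have e1 : ((n : ℝ) + 2) * (π / m) = (n + 1) * (π / m) + π / m := by ring
    have e2 : (n : ℝ) * (π / m) = (n + 1) * (π / m) - π / m := by ring
    rw [e1, e2, sin_add, sin_sub]
    ring

theorem dihedralCoeff_nonneg {m n : ℕ} (hm : m ≠ 1) (hn : m = 0 ∨ n ≤ m) :
    0 ≤ dihedralCoeff m n := by
  rcases eq_or_ne m 0 with rfl | h
  · simp [dihedralCoeff]
  · have h0 := sin_pi_div_pos (m := m) (by lia)
    simp only [dihedralCoeff, h, if_false]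
    apply div_nonneg _ h0.le
    apply sin_nonneg_of_nonneg_of_le_pi (by positivity)
    have : (n : ℝ) ≤ m := by exact_mod_cast hn.resolve_left h
    have hm0 : (0 : ℝ) < m := by positivity
    rw [mul_div_assoc', div_le_iff₀ hm0]
    nlinarith [pi_pos]

theorem dihedralCoeff_pos {m n : ℕ} (hm : 2 ≤ m) (h0 : 0 < n) (hn : n < m) :
    0 < dihedralCoeff m n := by
  have hs := sin_pi_div_pos hm
  simp only [dihedralCoeff, (by lia : m ≠ 0), if_false]
  apply div_pos _ hs
  have : (n : ℝ) < m := by exact_mod_cast hn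
  have hn0 : (0 : ℝ) < n := by exact_mod_cast h0
  have hm0 : (0 : ℝ) < m := hn0.trans this
  apply sin_pos_of_pos_of_lt_pi (by positivity)
  rw [mul_div_assoc', div_lt_iff₀ hm0]
  nlinarith [pi_pos]

theorem dihedralCoeff_self (m : ℕ) : dihedralCoeff m m = 0 := by
  rcases eq_or_ne m 0 with rfl | h
  · simp [dihedralCoeff]
  · have : (m : ℝ) ≠ 0 := by exact_mod_cast h
    simp [dihedralCoeff, h, mul_div_cancel₀ _ this]

theorem dihedralCoeff_of_succ_eq {m n : ℕ} (hm : 2 ≤ m) (hn : n + 1 = m) :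
    dihedralCoeff m n = 1 := by
  have hs := sin_pi_div_pos hm
  have hm0 : (m : ℝ) ≠ 0 := by positivity
  simp only [dihedralCoeff, (by lia : m ≠ 0), if_false]
  have : (n : ℝ) = m - 1 := by rw [← hn]; push_cast; ring
  rw [this, sub_mul, mul_div_cancel₀ _ hm0, one_mul, sin_pi_sub, div_self hs.ne']

/-! ### The geometric representation of a Coxeter group -/

variable {I : Type*} (M : CoxeterMatrix I)

/-- The symmetric bilinear form of the geometric representation, with
`B(eᵢ, eⱼ) = -cos (π / M i j)`. Where `M i j = 0`, the label being infinite, the division by zero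
gives the customary value `-1`. -/
noncomputable def bilin : (I →₀ ℝ) →ₗ[ℝ] (I →₀ ℝ) →ₗ[ℝ] ℝ :=
  Finsupp.linearCombination ℝ fun i => Finsupp.linearCombination ℝ fun j => -cos (π / M i j)

/-- The simple root `eᵢ`. -/
noncomputable abbrev root (i : I) : I →₀ ℝ := Finsupp.single i 1

theorem bilin_root_root (i j : I) : M.bilin (root i) (root j) = -cos (π / M i j) := by
  simp [bilin]

theorem bilin_root_self (i : I) : M.bilin (root i) (root i) = 1 := by
  simp [bilin_root_root]

theorem bilin_comm (v w : I →₀ ℝ) : M.bilin v w = M.bilin w v := by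
  suffices M.bilin = M.bilin.flip from congr($this v w)
  ext i j
  simp [bilin, M.symmetric i j]

/-- The reflection of the geometric representation that sends `eᵢ` to `-eᵢ`. -/
noncomputable def simpleReflection (i : I) : (I →₀ ℝ) ≃ₗ[ℝ] (I →₀ ℝ) :=
  Module.reflection (x := root i) (f := (2 : ℝ) • M.bilin (root i)) (by
    rw [LinearMap.smul_apply, bilin_root_self, smul_eq_mul, mul_one])

theorem simpleReflection_apply (i : I) (v : I →₀ ℝ) :
    M.simpleReflection i v = v - (2 * M.bilin (root i) v) • root i := by
  rw [simpleReflection, Module.reflection_apply]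
  simp

theorem simpleReflection_root_self (i : I) : M.simpleReflection i (root i) = -root i :=
  Module.reflection_apply_self _

theorem simpleReflection_inv (i : I) : (M.simpleReflection i)⁻¹ = M.simpleReflection i :=
  Module.reflection_inv _

theorem bilin_simpleReflection (i : I) (v w : I →₀ ℝ) :
    M.bilin (M.simpleReflection i v) (M.simpleReflection i w) = M.bilin v w := by
  simp only [simpleReflection_apply, map_sub, map_smul, LinearMap.sub_apply, LinearMap.smul_apply,
    smul_eq_mul, bilin_root_self, M.bilin_comm v (root i)]
  ring

/-- The alternating product of `n` simple reflections, applied to the simple root of the letter that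
would come next. -/
theorem altProd_simpleReflection_root {i j : I} (hij : i ≠ j) (n : ℕ) :
    altProd (M.simpleReflection i) (M.simpleReflection j) n (root (if Even n then i else j)) =
      dihedralCoeff (M i j) (n + 1) • root i + dihedralCoeff (M i j) n • root j := by
  have hm := M.off_diagonal i j hij
  induction n generalizing i j with
  | zero => simp [altProd, dihedralCoeff_zero, dihedralCoeff_one hm]
  | succ n ih =>
    have h := ih hij.symm (M.off_diagonal j i hij.symm)
    rw [altProd, LinearEquiv.mul_apply]
    have e : (if Even (n + 1) then i else j) = if Even n then j else i := by
      simp only [Nat.even_add_one]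
      split_ifs <;> rfl
    rw [e, h, M.symmetric j i, map_add, map_smul, map_smul, simpleReflection_root_self,
      simpleReflection_apply, bilin_root_root, dihedralCoeff_add_two hm]
    module

/-- A reflection is determined by its root and the bilinear form. -/
theorem mul_simpleReflection_of_apply_root {g : (I →₀ ℝ) ≃ₗ[ℝ] (I →₀ ℝ)}
    (hg : ∀ v w, M.bilin (g v) (g w) = M.bilin v w) {i j : I} (h : g (root i) = root j) :
    g * M.simpleReflection i = M.simpleReflection j * g := by
  ext1 v
  rw [LinearEquiv.mul_apply, LinearEquiv.mul_apply, simpleReflection_apply, simpleReflection_apply,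
    map_sub, map_smul, h, ← h, hg]

theorem bilin_altProd (i j : I) (n : ℕ) (v w : I →₀ ℝ) :
    M.bilin (altProd (M.simpleReflection i) (M.simpleReflection j) n v)
      (altProd (M.simpleReflection i) (M.simpleReflection j) n w) = M.bilin v w := by
  induction n generalizing i j with
  | zero => simp [altProd]
  | succ n ih => rw [altProd, LinearEquiv.mul_apply, LinearEquiv.mul_apply,
      bilin_simpleReflection, ih]

theorem altProd_simpleReflection_comm {i j : I} (hij : i ≠ j) (hm : M i j ≠ 0) :
    altProd (M.simpleReflection i) (M.simpleReflection j) (M i j) =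
      altProd (M.simpleReflection j) (M.simpleReflection i) (M i j) := by
  have hm1 := M.off_diagonal i j hij
  obtain ⟨n, hn⟩ : ∃ n, M i j = n + 1 := ⟨M i j - 1, by lia⟩
  -- The alternating product of `m - 1` factors maps a simple root to a simple root.
  have h := M.altProd_simpleReflection_root hij n
  rw [← hn, dihedralCoeff_self, dihedralCoeff_of_succ_eq (by lia) hn.symm, zero_smul, zero_add,
    one_smul] at h
  have h2 := M.mul_simpleReflection_of_apply_root (M.bilin_altProd i j n) h
  rw [hn, altProd, altProd, ← h2]
  -- It remains to split off the last factor of an alternating product.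
  clear h h2 hn hm1 hm hij
  rw [← altProd]
  induction n generalizing i j with
  | zero => simp [altProd]
  | succ n ih =>
    rw [altProd, ih, altProd, mul_assoc]
    simp only [Nat.even_add_one]
    split_ifs <;> rfl

theorem isLiftable_simpleReflection : M.IsLiftable M.simpleReflection := by
  intro i j
  rcases eq_or_ne i j with rfl | hij
  · rw [diagonal, pow_one, ← eq_inv_iff_mul_eq_one, simpleReflection_inv]
  · rcases eq_or_ne (M i j) 0 with h0 | h0
    · rw [h0, pow_zero]
    · rw [← altProd_comm_iff (M.simpleReflection_inv i) (M.simpleReflection_inv j)]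
      exact M.altProd_simpleReflection_comm hij h0

/-- The geometric representation of the Coxeter group. -/
noncomputable def geomRep : M.Group →* ((I →₀ ℝ) ≃ₗ[ℝ] (I →₀ ℝ)) :=
  M.toCoxeterSystem.lift ⟨M.simpleReflection, M.isLiftable_simpleReflection⟩

theorem geomRep_simple (i : I) : M.geomRep (M.simple i) = M.simpleReflection i := by
  rw [← M.toCoxeterSystem_simple]
  exact M.toCoxeterSystem.lift_apply_simple M.isLiftable_simpleReflection i

theorem simple_inv (i : I) : (M.simple i)⁻¹ = M.simple i := by
  rw [← M.toCoxeterSystem_simple]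
  exact M.toCoxeterSystem.inv_simple i

theorem simple_mul_self (i : I) : M.simple i * M.simple i = 1 := by
  rw [← M.toCoxeterSystem_simple]
  exact M.toCoxeterSystem.simple_mul_simple_self i

theorem altProd_simple_comm (i j : I) :
    altProd (M.simple i) (M.simple j) (M i j) = altProd (M.simple j) (M.simple i) (M i j) := by
  rw [altProd_comm_iff (M.simple_inv i) (M.simple_inv j), ← M.toCoxeterSystem_simple]
  exact M.toCoxeterSystem.simple_mul_simple_pow i j

theorem altEnd_simple_comm (i j : I) :
    altEnd (M.simple i) (M.simple j) (M i j) = altEnd (M.simple j) (M.simple i) (M i j) :=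
  (altEnd_comm_iff _ _ _).2 (M.altProd_simple_comm i j)

theorem bilin_geomRep (g : M.Group) (v w : I →₀ ℝ) :
    M.bilin (M.geomRep g v) (M.geomRep g w) = M.bilin v w := by
  induction g using M.toCoxeterSystem.simple_induction_left with
  | one => simp
  | mul_simple_left g i ih =>
    rw [map_mul, LinearEquiv.mul_apply, LinearEquiv.mul_apply, M.toCoxeterSystem_simple,
      geomRep_simple, bilin_simpleReflection, ih]

theorem geomRep_simple_mul (g : M.Group) (i : I) (v : I →₀ ℝ) :
    M.geomRep (M.simple i * g) v = M.simpleReflection i (M.geomRep g v) := by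
  rw [map_mul, LinearEquiv.mul_apply, geomRep_simple]

theorem geomRep_mul_simple_root (g : M.Group) (i : I) :
    M.geomRep (g * M.simple i) (root i) = -M.geomRep g (root i) := by
  rw [map_mul, LinearEquiv.mul_apply, geomRep_simple, simpleReflection_root_self, map_neg]

theorem geomRep_inv_apply_eq_iff {g : M.Group} {v w : I →₀ ℝ} :
    M.geomRep g⁻¹ v = w ↔ M.geomRep g w = v := by
  rw [map_inv]
  exact (LinearEquiv.symm_apply_eq _).trans eq_comm

/-- A root that is a nonnegative multiple of a simple root is that simple root. -/
theorem geomRep_root_eq_root {g : M.Group} {i j : I} {r : ℝ} (hr : 0 ≤ r)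
    (h : M.geomRep g (root i) = r • root j) : M.geomRep g (root i) = root j := by
  have h1 := M.bilin_geomRep g (root i) (root i)
  rw [h, map_smul, map_smul, LinearMap.smul_apply, bilin_root_self, bilin_root_self, smul_eq_mul,
    smul_eq_mul, mul_one, mul_self_eq_one_iff] at h1
  rcases h1 with rfl | rfl
  · rw [h, one_smul]
  · norm_num at hr

/-- The variant of `altProd_simpleReflection_root` where the last letter of the product, not its
first, is prescribed. -/
theorem geomRep_altEnd_root {i j : I} (hij : i ≠ j) (n : ℕ) :
    ∃ k l, (k = i ∧ l = j ∨ k = j ∧ l = i) ∧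
      M.geomRep (altEnd (M.simple j) (M.simple i) n) (root i) =
        dihedralCoeff (M i j) (n + 1) • root k + dihedralCoeff (M i j) n • root l := by
  rw [map_altEnd, altEnd_eq_altProd, geomRep_simple, geomRep_simple]
  split_ifs with h
  · have := M.altProd_simpleReflection_root hij n
    rw [if_pos h] at this
    exact ⟨i, j, Or.inl ⟨rfl, rfl⟩, this⟩
  · have := M.altProd_simpleReflection_root hij.symm n
    rw [if_neg h, M.symmetric j i] at this
    exact ⟨j, i, Or.inr ⟨rfl, rfl⟩, this⟩

/-! ### Positivity of roots -/

/-- The word length of an element of the Coxeter group. -/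
noncomputable abbrev len (g : M.Group) : ℕ := M.toCoxeterSystem.length g

theorem len_altEnd_le (i j : I) (n : ℕ) : M.len (altEnd (M.simple i) (M.simple j) n) ≤ n := by
  induction n generalizing i j with
  | zero => simp [altEnd]
  | succ n ih =>
    rw [altEnd, ← M.toCoxeterSystem_simple]
    refine (M.toCoxeterSystem.length_mul_le _ _).trans ?_
    rw [M.toCoxeterSystem.length_simple, M.toCoxeterSystem_simple]
    exact Nat.add_le_add_right (ih j i) 1

theorem len_mul_simple (g : M.Group) (i : I) :
    M.len (g * M.simple i) = M.len g + 1 ∨ M.len (g * M.simple i) + 1 = M.len g := by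
  rw [← M.toCoxeterSystem_simple]
  exact M.toCoxeterSystem.length_mul_simple g i

/-- The key property of the geometric representation. Write `w = v u` with `u` an alternating
product of `q` letters that ends with a right descent `t` of `w`, with `ℓ(w) = ℓ(v) + q` and `q` as
large as possible. Then `v` has neither descent `i` nor `t`, and as `i` is not a descent of `w`, `q`
is less than `M i t`, so that `u eᵢ` is a nonnegative combination of `eᵢ` and `eₜ`. -/
theorem geomRep_root_nonneg (w : M.Group) (i : I) (h : M.len w < M.len (w * M.simple i)) :
    0 ≤ M.geomRep w (root i) := by
  induction hn : M.len w using Nat.strong_induction_on generalizing w i with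
  | _ n ih =>
  subst hn
  rcases eq_or_ne w 1 with rfl | hw
  · simp
  obtain ⟨t, ht⟩ := M.toCoxeterSystem.exists_rightDescent_of_ne_one hw
  change M.len (w * _) < M.len w at ht
  rw [M.toCoxeterSystem_simple] at ht
  have hit : i ≠ t := by
    rintro rfl
    lia
  let P (q : ℕ) : Prop :=
    ∃ v, w = v * altEnd (M.simple t) (M.simple i) q ∧ M.len v + q = M.len w
  have hP1 : P 1 := by
    refine ⟨w * M.simple t, ?_, ?_⟩
    · simp [altEnd, mul_assoc, simple_mul_self]
    · rcases M.len_mul_simple w t with h | h <;> lia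
  obtain ⟨q, hq1, ⟨v, hwv, hlen⟩, hq⟩ : ∃ q, 1 ≤ q ∧ P q ∧ ¬ P (q + 1) := by
    by_contra! hc
    have : P (M.len w + 1) :=
      Nat.le_induction (P := fun q _ => P q) hP1 hc _ (Nat.le_add_left 1 _)
    obtain ⟨v, -, hv⟩ := this
    lia
  -- Otherwise this letter could be moved from `v` to the alternating product.
  have hv1 : M.len v < M.len (v * if Even q then M.simple t else M.simple i) := by
    by_contra hc
    apply hq
    refine ⟨v * if Even q then M.simple t else M.simple i, ?_, ?_⟩
    · rw [altEnd_succ', mul_assoc, ← mul_assoc (ite _ _ _) (ite _ _ _)]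
      split_ifs <;> simpa [simple_mul_self] using hwv
    · have h1 := M.len_mul_simple v t
      have h2 := M.len_mul_simple v i
      split_ifs at hc ⊢ <;> lia
  -- The other letter is the first one of the alternating product.
  have hv2 : M.len v < M.len (v * if Even q then M.simple i else M.simple t) := by
    obtain ⟨p, rfl⟩ : ∃ p, q = p + 1 := ⟨q - 1, by lia⟩
    rw [altEnd_succ', ← mul_assoc] at hwv
    have h1 := M.toCoxeterSystem.length_mul_le (v * if Even p then M.simple t else M.simple i)
      (altEnd (M.simple t) (M.simple i) p)
    have h2 := M.len_altEnd_le t i p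
    rw [← hwv] at h1
    simp only [Nat.even_add_one, ite_not]
    simp only [len] at *
    lia
  have hv (k : I) (hk : k = i ∨ k = t) : 0 ≤ M.geomRep v (root k) := by
    refine ih (M.len v) (by lia) v k ?_ rfl
    split_ifs at hv1 hv2 <;> rcases hk with rfl | rfl <;> assumption
  -- By the braid relation, a product of `M i t` factors could be made to end with `i`.
  have hqm : M i t = 0 ∨ q < M i t := by
    by_contra! hc
    obtain ⟨hm0, hm⟩ := hc
    obtain ⟨p, hp⟩ : ∃ p, M i t = p + 1 := ⟨M i t - 1, by lia⟩
    obtain ⟨d, rfl⟩ : ∃ d, q = d + M i t := ⟨q - M i t, by lia⟩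
    have hd : ∃ u, M.len u ≤ d ∧ altEnd (M.simple t) (M.simple i) (d + M i t) =
        u * altEnd (M.simple t) (M.simple i) (M i t) := by
      rw [altEnd_add]
      refine ⟨_, ?_, rfl⟩
      split_ifs <;> apply len_altEnd_le
    obtain ⟨u, hu, he⟩ := hd
    rw [he, ← altEnd_simple_comm, hp, altEnd] at hwv
    have h1 : w * M.simple i = v * (u * altEnd (M.simple t) (M.simple i) p) := by
      rw [hwv]
      simp [mul_assoc, simple_mul_self]
    have h2 := M.toCoxeterSystem.length_mul_le v (u * altEnd (M.simple t) (M.simple i) p)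
    have h3 := M.toCoxeterSystem.length_mul_le u (altEnd (M.simple t) (M.simple i) p)
    have h4 := M.len_altEnd_le t i p
    rw [← h1] at h2
    simp only [len] at *
    lia
  obtain ⟨k, l, hkl, he⟩ := M.geomRep_altEnd_root hit q
  have hm := M.off_diagonal i t hit
  rw [hwv, map_mul, LinearEquiv.mul_apply, he, map_add, map_smul, map_smul]
  exact add_nonneg
    (smul_nonneg (dihedralCoeff_nonneg hm (by lia)) (hv k (by tauto)))
    (smul_nonneg (dihedralCoeff_nonneg hm (by lia)) (hv l (by tauto)))

theorem geomRep_root_nonneg_or_nonpos (w : M.Group) (i : I) :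
    0 ≤ M.geomRep w (root i) ∨ M.geomRep w (root i) ≤ 0 := by
  rcases M.len_mul_simple w i with h | h
  · exact Or.inl (M.geomRep_root_nonneg w i (by lia))
  · right
    rw [← neg_nonneg, ← geomRep_mul_simple_root]
    apply M.geomRep_root_nonneg
    rw [mul_assoc, simple_mul_self, mul_one]
    lia

end CoxeterMatrix

/-! ### Minimal coset representatives -/

namespace CoxeterMatrix

open Real ArtinTits

variable {I : Type*} (M : CoxeterMatrix I)

theorem root_injective : Function.Injective (root : I → I →₀ ℝ) :=
  Finsupp.single_left_injective one_ne_zero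

theorem eq_smul_root_of_add_eq {p q : I →₀ ℝ} {x : I} {α β : ℝ} (hα : 0 < α) (hβ : 0 ≤ β)
    (hp : 0 ≤ p) (hq : 0 ≤ q) (h : α • p + β • q = root x) : p = p x • root x := by
  ext k
  rcases eq_or_ne k x with rfl | hk
  · simp
  · have h1 := DFunLike.congr_fun h k
    simp only [Finsupp.add_apply, Finsupp.smul_apply, smul_eq_mul,
      Finsupp.single_eq_of_ne hk] at h1
    have h2 : 0 ≤ β * q k := mul_nonneg hβ (hq k)
    have h3 : 0 ≤ p k := hp k
    have h4 : p k = 0 := by nlinarith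
    simp [h4, hk]

theorem not_root_nonpos (x : I) : ¬ (root x : I →₀ ℝ) ≤ 0 := by
  intro h
  have := h x
  simp at this
  linarith

/-- If a root `w eₓ` is positive but its image under the `i`-th simple reflection is not, then it
is the simple root `eᵢ`. -/
theorem geomRep_eq_root_of_nonneg {w : M.Group} {x i : I} (h : 0 ≤ M.geomRep w (root x))
    (h' : ¬ 0 ≤ M.geomRep (M.simple i * w) (root x)) : M.geomRep w (root x) = root i := by
  have h2 := (M.geomRep_root_nonneg_or_nonpos (M.simple i * w) x).resolve_left h'
  apply M.geomRep_root_eq_root (h i)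
  ext k
  rcases eq_or_ne k i with rfl | hk
  · simp
  · have h3 := h2 k
    rw [geomRep_simple_mul, simpleReflection_apply] at h3
    simp only [Finsupp.sub_apply, Finsupp.smul_apply, smul_eq_mul,
      Finsupp.single_eq_of_ne hk] at h3
    have h4 := h k
    simp only [Finsupp.coe_zero, Pi.zero_apply, mul_zero, sub_zero] at h3 h4
    simp [hk, le_antisymm h3 h4]

/-- The elements `g` of the Coxeter group that are minimal in their coset `g W_X`, which are those
that map the simple roots in `X` to positive roots. -/
def MinRep (X : Set I) : Type _ :=
  {g : M.Group // ∀ x ∈ X, 0 ≤ M.geomRep g (root x)}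

variable {M} {X : Set I}

namespace MinRep

/-- The vertex `x ∈ X` satisfies `sᵢ c = c sₓ`: left multiplication by `sᵢ` fixes the coset `c W_X`.
This is expressed in terms of roots. -/
def Loop (c : M.MinRep X) (i x : I) : Prop := M.geomRep c.1 (root x) = root i

/-- Left multiplication by `sᵢ` fixes the coset `c W_X`. -/
def HasLoop (c : M.MinRep X) (i : I) : Prop := ∃ x ∈ X, c.Loop i x

theorem Loop.eq {c : M.MinRep X} {i x y : I} (hx : c.Loop i x) (hy : c.Loop i y) : x = y :=
  root_injective ((M.geomRep c.1).injective (Eq.trans hx (Eq.symm hy)))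

theorem Loop.eq_left {c : M.MinRep X} {i j x : I} (hx : c.Loop i x) (hy : c.Loop j x) : i = j :=
  root_injective (Eq.trans (Eq.symm hx) hy)

/-- Two loops at the same coset are labelled by vertices with the same entry of the Coxeter matrix,
as the representation preserves the bilinear form and `cos` is injective on `[0, π]`. -/
theorem Loop.label_eq {c : M.MinRep X} {i j x y : I} (hx : c.Loop i x) (hy : c.Loop j y) :
    M x y = M i j := by
  have h := M.bilin_geomRep c.1 (root x) (root y)
  rw [hx, hy, bilin_root_root, bilin_root_root, neg_inj] at h
  have hmem (n : ℕ) : π / n ∈ Set.Icc 0 π := by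
    refine ⟨by positivity, ?_⟩
    rcases Nat.eq_zero_or_pos n with rfl | hn
    · simp [pi_pos.le]
    · exact div_le_self pi_pos.le (by exact_mod_cast hn)
  have h1 := injOn_cos (hmem _) (hmem _) h
  rw [div_eq_mul_inv, div_eq_mul_inv, mul_right_inj' pi_ne_zero, inv_inj] at h1
  exact_mod_cast h1.symm

variable (X) in
/-- The trivial element, as a minimal representative of `W_X`. -/
def base : M.MinRep X := ⟨1, fun x _ => by simp⟩

theorem loop_base (i : I) : (base X : M.MinRep X).Loop i i := by simp [Loop, base]

theorem hasLoop_base_iff (i : I) : (base X : M.MinRep X).HasLoop i ↔ i ∈ X := by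
  constructor
  · rintro ⟨x, hx, h⟩
    rwa [h.eq_left (loop_base x)]
  · exact fun h => ⟨i, h, loop_base i⟩

/-- Left multiplication by `sᵢ`, which preserves minimality where it does not fix the coset. -/
def move (c : M.MinRep X) (i : I) (h : ¬ c.HasLoop i) : M.MinRep X :=
  ⟨M.simple i * c.1, fun x hx => by
    by_contra hc
    exact h ⟨x, hx, M.geomRep_eq_root_of_nonneg (c.2 x hx) hc⟩⟩

theorem not_hasLoop_move (c : M.MinRep X) (i : I) (h : ¬ c.HasLoop i) :
    ¬ (c.move i h).HasLoop i := by
  rintro ⟨x, hx, hl⟩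
  have h1 := c.2 x hx
  have h2 : M.simpleReflection i (M.geomRep c.1 (root x)) = root i := by
    rw [← geomRep_simple_mul]
    exact hl
  have h3 := congrArg (M.simpleReflection i) h2
  rw [← geomRep_simple_mul, ← geomRep_simple_mul, ← mul_assoc, simple_mul_self, one_mul,
    simpleReflection_root_self] at h3
  rw [h3, neg_nonneg] at h1
  exact not_root_nonpos i h1

theorem move_move (c : M.MinRep X) (i : I) (h : ¬ c.HasLoop i) :
    (c.move i h).move i (c.not_hasLoop_move i h) = c :=
  Subtype.ext (by simp [move, ← mul_assoc, simple_mul_self])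

/-! ### The orbits of a rank two subgroup -/

/-- The coset `c'` is obtained from `c` by successive nontrivial moves by `sᵢ` and `sⱼ`. -/
def Reach (i j : I) : M.MinRep X → M.MinRep X → Prop :=
  Relation.ReflTransGen fun c c' => ∃ l, (l = i ∨ l = j) ∧ ∃ h, c' = c.move l h

/-- The element `c` has no left descent among `sᵢ` and `sⱼ`. -/
def IsBottom (i j : I) (c : M.MinRep X) : Prop :=
  0 ≤ M.geomRep c.1⁻¹ (root i) ∧ 0 ≤ M.geomRep c.1⁻¹ (root j)

/-- Every orbit has a bottom, which is reached by moving along left descents. -/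
theorem exists_bottom (i j : I) (c : M.MinRep X) : ∃ c₀, IsBottom i j c₀ ∧ Reach i j c₀ c := by
  induction hn : M.len c.1 using Nat.strong_induction_on generalizing c with
  | _ n ih =>
  subst hn
  have key (l : I) (hl : l = i ∨ l = j) : (∃ c₀, IsBottom i j c₀ ∧ Reach i j c₀ c) ∨
      0 ≤ M.geomRep c.1⁻¹ (root l) := by
    by_cases hd : M.len (M.simple l * c.1) < M.len c.1
    · left
      have hloop : ¬ c.HasLoop l := by
        rintro ⟨x, hx, h⟩
        have h1 : 0 ≤ M.geomRep (M.simple l * c.1)⁻¹ (root l) := by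
          apply M.geomRep_root_nonneg
          have : (M.simple l * c.1)⁻¹ * M.simple l = c.1⁻¹ := by
            rw [mul_inv_rev, mul_assoc, simple_inv, simple_mul_self, mul_one]
          rw [this]
          simpa only [len, CoxeterSystem.length_inv] using hd
        rw [mul_inv_rev, simple_inv, geomRep_mul_simple_root, M.geomRep_inv_apply_eq_iff.2 h,
          neg_nonneg] at h1
        exact not_root_nonpos x h1
      obtain ⟨c₀, h0, hr⟩ := ih _ hd (c.move l hloop) rfl
      exact ⟨c₀, h0, hr.tail ⟨l, hl, c.not_hasLoop_move l hloop, (c.move_move l hloop).symm⟩⟩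
    · right
      apply M.geomRep_root_nonneg
      have h1 := M.len_mul_simple c.1⁻¹ l
      have h2 : M.len (c.1⁻¹ * M.simple l) = M.len (M.simple l * c.1) := by
        rw [len, ← CoxeterSystem.length_inv, mul_inv_rev, inv_inv, simple_inv]
      have h3 : M.len c.1⁻¹ = M.len c.1 := M.toCoxeterSystem.length_inv _
      lia
  rcases key i (Or.inl rfl) with h | hi
  · exact h
  rcases key j (Or.inr rfl) with h | hj
  · exact h
  exact ⟨c, ⟨hi, hj⟩, Relation.ReflTransGen.refl⟩

/-- The images `c⁻¹ eᵢ` and `c⁻¹ eⱼ` are nonnegative, so a simple root that is a nonnegative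
combination of them is proportional to those that occur in it. -/
theorem IsBottom.loop_of_add_eq {i j x : I} {c : M.MinRep X} (hc : IsBottom i j c) {α β : ℝ}
    (hα : 0 < α) (hβ : 0 ≤ β)
    (h : α • M.geomRep c.1⁻¹ (root i) + β • M.geomRep c.1⁻¹ (root j) = root x) : c.Loop i x := by
  have h1 := eq_smul_root_of_add_eq hα hβ hc.1 hc.2 h
  exact M.geomRep_inv_apply_eq_iff.1 (M.geomRep_root_eq_root (hc.1 x) h1)

theorem IsBottom.symm {i j : I} {c : M.MinRep X} (hc : IsBottom i j c) : IsBottom j i c :=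
  ⟨hc.2, hc.1⟩

theorem Reach.exists_mul {i j : I} {c₀ c : M.MinRep X} (h : Reach i j c₀ c) :
    ∃ u ∈ Subgroup.closure {M.simple i, M.simple j}, c.1 = u * c₀.1 := by
  induction h with
  | refl => exact ⟨1, one_mem _, (one_mul _).symm⟩
  | tail _ h ih =>
    obtain ⟨u, hu, he⟩ := ih
    obtain ⟨l, hl, h, rfl⟩ := h
    refine ⟨M.simple l * u, mul_mem (Subgroup.subset_closure ?_) hu, ?_⟩
    · rcases hl with rfl | rfl <;> simp
    · change M.simple l * _ = _
      rw [he, mul_assoc]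

theorem geomRep_mem_span {i j : I} {u : M.Group}
    (hu : u ∈ Subgroup.closure {M.simple i, M.simple j}) {v : I →₀ ℝ}
    (hv : v ∈ Submodule.span ℝ {root i, root j}) :
    M.geomRep u v ∈ Submodule.span ℝ {root i, root j} := by
  have hs (l : I) (hl : l = i ∨ l = j) {v : I →₀ ℝ}
      (hv : v ∈ Submodule.span ℝ {root i, root j}) :
      M.geomRep (M.simple l) v ∈ Submodule.span ℝ {root i, root j} := by
    rw [geomRep_simple, simpleReflection_apply]
    refine sub_mem hv (Submodule.smul_mem _ _ (Submodule.subset_span ?_))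
    rcases hl with rfl | rfl <;> simp
  induction hu using Subgroup.closure_induction_left generalizing v with
  | one => simpa
  | mul_left x hx y hy ih =>
    rw [map_mul, LinearEquiv.mul_apply]
    rcases hx with rfl | rfl
    · exact hs i (Or.inl rfl) (ih hv)
    · exact hs j (Or.inr rfl) (ih hv)
  | inv_mul_cancel x hx y hy ih =>
    rw [map_mul, LinearEquiv.mul_apply]
    rcases hx with rfl | rfl
    · rw [simple_inv]; exact hs i (Or.inl rfl) (ih hv)
    · rw [simple_inv]; exact hs j (Or.inr rfl) (ih hv)

/-- If the bottom of an orbit has no loops, no point of the orbit has. -/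
theorem Reach.not_hasLoop {i j : I} (hij : i ≠ j) {c₀ c : M.MinRep X} (h₀ : IsBottom i j c₀)
    (hi : ¬ c₀.HasLoop i) (hj : ¬ c₀.HasLoop j) (h : Reach i j c₀ c) {l : I} (hl : l = i ∨ l = j) :
    ¬ c.HasLoop l := by
  rintro ⟨x, hx, hloop⟩
  obtain ⟨u, hu, hc⟩ := h.exists_mul
  have hmem : M.geomRep u⁻¹ (root l) ∈ Submodule.span ℝ {root i, root j} :=
    geomRep_mem_span (inv_mem hu) (Submodule.subset_span (by rcases hl with rfl | rfl <;> simp))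
  obtain ⟨α, β, hαβ⟩ := Submodule.mem_span_pair.1 hmem
  have heq : α • M.geomRep c₀.1⁻¹ (root i) + β • M.geomRep c₀.1⁻¹ (root j) = root x := by
    rw [← map_smul, ← map_smul, ← map_add, hαβ, ← LinearEquiv.mul_apply, ← map_mul, ← mul_inv_rev,
      ← hc]
    exact M.geomRep_inv_apply_eq_iff.2 hloop
  have hα : (M.geomRep u⁻¹ (root l)) i = α := by rw [← hαβ]; simp [hij]
  have hβ : (M.geomRep u⁻¹ (root l)) j = β := by rw [← hαβ]; simp [hij.symm]
  rcases M.geomRep_root_nonneg_or_nonpos u⁻¹ l with hs | hs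
  · have hα0 : 0 ≤ α := hα ▸ hs i
    have hβ0 : 0 ≤ β := hβ ▸ hs j
    rcases hα0.eq_or_lt with rfl | hα1
    · rcases hβ0.eq_or_lt with rfl | hβ1
      · rw [zero_smul, zero_smul, add_zero] at heq
        exact not_root_nonpos x heq.ge
      · exact hj ⟨x, hx, h₀.symm.loop_of_add_eq hβ1 le_rfl (by rw [add_comm]; exact heq)⟩
    · exact hi ⟨x, hx, h₀.loop_of_add_eq hα1 hβ0 heq⟩
  · have hα0 : α ≤ 0 := hα ▸ hs i
    have hβ0 : β ≤ 0 := hβ ▸ hs j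
    exact not_root_nonpos x (heq ▸ add_nonpos (smul_nonpos_of_nonpos_of_nonneg hα0 h₀.1)
      (smul_nonpos_of_nonpos_of_nonneg hβ0 h₀.2))

end MinRep

end CoxeterMatrix

/-! ### Braid relations on a path -/

namespace CoxeterMatrix

open Real ArtinTits

theorem altEnd_up {C A : Type*} {f : ℕ → Equiv.Perm (C × A)} (hf : ∀ k, f (k + 2) = f k)
    {c : ℕ → C} {n : ℕ} (hup : ∀ k < n, ∀ a, f k (c k, a) = (c (k + 1), a))
    (d k : ℕ) (hk : k + d ≤ n) (a : A) :
    altEnd (f k) (f (k + 1)) d (c k, a) = (c (k + d), a) := by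
  induction d generalizing k with
  | zero => rfl
  | succ d ih =>
    rw [altEnd, Equiv.Perm.mul_apply, hup k (by lia), ← hf k, ih (k + 1) (by lia),
      add_assoc, add_comm 1]

theorem altEnd_down {C A : Type*} {f : ℕ → Equiv.Perm (C × A)} (hf : ∀ k, f (k + 2) = f k)
    {c : ℕ → C} {n : ℕ} (hdown : ∀ k < n, ∀ a, f k (c (k + 1), a) = (c k, a))
    (d k : ℕ) (hk : k + d ≤ n) (a : A) :
    altEnd (f (k + d + 1)) (f (k + d)) d (c (k + d), a) = (c k, a) := by
  induction d with
  | zero => rfl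
  | succ d ih =>
    rw [altEnd, Equiv.Perm.mul_apply, ← add_assoc, hf, hdown _ (by lia), ih (by lia)]

/-- Two permutations `f 0`, `f 1` of `C × A` that act on a path `c 0, …, c n` in `C`, moving along
its edges alternately, and by multiplication by `t` at both ends, satisfy the braid relation of
length `n + 1` there: either side passes through exactly one end and arrives at the mirror image of
the starting point. -/
theorem altEnd_line {C A : Type*} [Group A] {f : ℕ → Equiv.Perm (C × A)}
    (hf : ∀ k, f (k + 2) = f k) {c : ℕ → C} {n : ℕ} {t : A}
    (hup : ∀ k < n, ∀ a, f k (c k, a) = (c (k + 1), a))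
    (hdown : ∀ k < n, ∀ a, f k (c (k + 1), a) = (c k, a))
    (hbot : ∀ a, f 1 (c 0, a) = (c 0, t * a)) (htop : ∀ a, f n (c n, a) = (c n, t * a))
    {k d : ℕ} (hk : k + d = n) (a : A) :
    altEnd (f 0) (f 1) (n + 1) (c k, a) = altEnd (f 1) (f 0) (n + 1) (c k, a) := by
  have h1 (d' : ℕ) (hd' : d' ≤ n) :
      altEnd (f k) (f (k + 1)) (d' + 1 + d) (c k, a) = (c (n - d'), t * a) := by
    induction d generalizing k with
    | zero =>
      obtain rfl : k = n := hk
      rw [add_zero, altEnd, Equiv.Perm.mul_apply, htop]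
      obtain ⟨e, rfl⟩ : ∃ e, k = e + d' := ⟨k - d', by lia⟩
      rw [altEnd_down hf hdown d' e le_rfl, Nat.add_sub_cancel]
    | succ d ih =>
      rw [← add_assoc, altEnd, Equiv.Perm.mul_apply, hup k (by lia), ← hf k, ih (by lia)]
  have h2 (k d' : ℕ) (hk : k ≤ n) (hd' : d' ≤ n) :
      altEnd (f (k + 1)) (f k) (d' + 1 + k) (c k, a) = (c d', t * a) := by
    induction k with
    | zero =>
      have := altEnd_up hf hup d' 0 (by lia) (t * a)
      rw [zero_add] at this
      rw [add_zero, altEnd, Equiv.Perm.mul_apply, zero_add, hbot, this, zero_add]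
    | succ k ih =>
      rw [← add_assoc, altEnd, Equiv.Perm.mul_apply, hf, hdown k (by lia), ih (by lia)]
  have h3 : altEnd (f k) (f (k + 1)) (n + 1) (c k, a) =
      altEnd (f (k + 1)) (f k) (n + 1) (c k, a) := by
    have e1 := h1 k (by lia)
    have e2 := h2 k d (by lia) (by lia)
    rw [show k + 1 + d = n + 1 by lia, show n - k = d by lia] at e1
    rw [show d + 1 + k = n + 1 by lia] at e2
    rw [e1, e2]
  have h4 : ∀ k, (f k = f 0 ∧ f (k + 1) = f 1) ∨ (f k = f 1 ∧ f (k + 1) = f 0) := by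
    intro k
    induction k with
    | zero => exact Or.inl ⟨rfl, rfl⟩
    | succ k ih =>
      rw [hf]
      tauto
  rcases h4 k with ⟨h5, h6⟩ | ⟨h5, h6⟩
  · rwa [h5, h6] at h3
  · rw [h5, h6] at h3
    exact h3.symm

/-! ### The action of the generators and its braid relations -/

namespace MinRep

variable {I : Type*} {M : CoxeterMatrix I} {X : Set I} {A : Type*} [Group A] (σ : X → A)

open Classical in
/-- The action of a generator on the pairs of a coset of `W_X` and an element of a group `A`: it
acts on the coset where it moves it, and on the element of `A`, through `σₓ`, where `sᵢ c = c sₓ`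
with `x ∈ X`. -/
noncomputable def step (i : I) : Equiv.Perm (M.MinRep X × A) where
  toFun p := if h : p.1.HasLoop i then (p.1, σ ⟨h.choose, h.choose_spec.1⟩ * p.2)
    else (p.1.move i h, p.2)
  invFun p := if h : p.1.HasLoop i then (p.1, (σ ⟨h.choose, h.choose_spec.1⟩)⁻¹ * p.2)
    else (p.1.move i h, p.2)
  left_inv := by
    rintro ⟨c, a⟩
    by_cases h : c.HasLoop i
    · simp [h]
    · simp [h, c.not_hasLoop_move i h, move_move]
  right_inv := by
    rintro ⟨c, a⟩
    by_cases h : c.HasLoop i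
    · simp [h]
    · simp [h, c.not_hasLoop_move i h, move_move]

theorem step_of_not_hasLoop {c : M.MinRep X} {i : I} (h : ¬ c.HasLoop i) (a : A) :
    step σ i (c, a) = (c.move i h, a) := by
  simp [step, h]

theorem step_of_loop {c : M.MinRep X} {i : I} (x : X) (h : c.Loop i x) (a : A) :
    step σ i (c, a) = (c, σ x * a) := by
  have h1 : c.HasLoop i := ⟨x, x.2, h⟩
  have h2 : (⟨h1.choose, h1.choose_spec.1⟩ : X) = x := Subtype.ext (h1.choose_spec.2.eq h)
  simp [step, h1, h2]

theorem altEnd_step_of_loop {c : M.MinRep X} {i j : I} {x y : X} (hx : c.Loop i x)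
    (hy : c.Loop j y) (n : ℕ) (a : A) :
    altEnd (step σ i) (step σ j) n (c, a) = (c, altEnd (σ x) (σ y) n * a) := by
  induction n generalizing i j x y a with
  | zero => simp [altEnd]
  | succ n ih =>
    rw [altEnd, Equiv.Perm.mul_apply, step_of_loop σ x hx, ih hy hx, altEnd, mul_assoc]

theorem altEnd_step_of_not_hasLoop {c₀ c : M.MinRep X} {i j : I} (hr : Reach i j c₀ c)
    (hno : ∀ c, Reach i j c₀ c → ∀ l, l = i ∨ l = j → ¬ c.HasLoop l) (n : ℕ) (a : A) :
    (altEnd (step σ i) (step σ j) n (c, a)).1.1 = altEnd (M.simple i) (M.simple j) n * c.1 ∧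
      (altEnd (step σ i) (step σ j) n (c, a)).2 = a ∧
      Reach i j c₀ (altEnd (step σ i) (step σ j) n (c, a)).1 := by
  induction n with
  | zero => simpa [altEnd] using hr
  | succ n ih =>
    obtain ⟨h1, h2, h3⟩ := ih
    have key (l : I) (hl : l = i ∨ l = j) {p : M.MinRep X × A} (hp1 : p.1.1 =
        altEnd (M.simple i) (M.simple j) n * c.1) (hp2 : p.2 = a) (hp3 : Reach i j c₀ p.1) :
        (step σ l p).1.1 = M.simple l * altEnd (M.simple i) (M.simple j) n * c.1 ∧
        (step σ l p).2 = a ∧ Reach i j c₀ (step σ l p).1 := by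
      rw [step_of_not_hasLoop σ (hno _ hp3 l hl)]
      refine ⟨?_, hp2, hp3.tail ⟨l, hl, hno _ hp3 l hl, rfl⟩⟩
      change M.simple l * _ = _
      rw [hp1, mul_assoc]
    rw [altEnd_succ', altEnd_succ', Equiv.Perm.mul_apply]
    split_ifs
    · exact key i (Or.inl rfl) h1 h2 h3
    · exact key j (Or.inr rfl) h1 h2 h3

/-- The letters `j, i, j, i, …`. -/
def letter (i j : I) (k : ℕ) : I := if Even k then j else i

theorem letter_add_two (i j : I) (k : ℕ) : letter i j (k + 2) = letter i j k := by
  simp [letter, Nat.even_add]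

open Classical in
/-- The path in the orbit of `c₀` obtained by moving by `sⱼ, sᵢ, sⱼ, …` in turn,
which stays in place where the next letter fixes the coset. -/
noncomputable def line (c₀ : M.MinRep X) (i j : I) : ℕ → M.MinRep X
  | 0 => c₀
  | k + 1 => if h : (line c₀ i j k).HasLoop (letter i j k) then line c₀ i j k
    else (line c₀ i j k).move (letter i j k) h

theorem line_succ {c₀ : M.MinRep X} {i j : I} {k : ℕ}
    (h : ¬ (line c₀ i j k).HasLoop (letter i j k)) :
    line c₀ i j (k + 1) = (line c₀ i j k).move (letter i j k) h := by
  rw [line, dif_neg h]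

theorem inv_altEnd_root {i j : I} (hij : i ≠ j) (c₀ : M.MinRep X) (k : ℕ) :
    M.geomRep (altEnd (M.simple j) (M.simple i) k * c₀.1)⁻¹ (root (letter i j k)) =
      dihedralCoeff (M i j) (k + 1) • M.geomRep c₀.1⁻¹ (root j) +
        dihedralCoeff (M i j) k • M.geomRep c₀.1⁻¹ (root i) := by
  rw [mul_inv_rev, ← altProd_inv (M.simple_inv j) (M.simple_inv i), inv_inv, map_mul,
    LinearEquiv.mul_apply, map_altProd, geomRep_simple, geomRep_simple, letter,
    M.altProd_simpleReflection_root hij.symm, M.symmetric j i, map_add, map_smul, map_smul]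

/-- Where `c₀` has no loop at `j`, the path that starts at `c₀` has none before its last point: the
coefficient of `c₀⁻¹ eⱼ` in the root to be compared with the simple roots in `X` is positive. -/
theorem not_hasLoop_of_val {i j : I} (hij : i ≠ j) {n k : ℕ} (hm : M i j = n + 1) (hk : k < n)
    {c₀ c : M.MinRep X} (h₀ : IsBottom i j c₀) (hj : ¬ c₀.HasLoop j)
    (hc : c.1 = altEnd (M.simple j) (M.simple i) k * c₀.1) : ¬ c.HasLoop (letter i j k) := by
  rintro ⟨y, hy, h⟩
  have h1 := M.geomRep_inv_apply_eq_iff.2 h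
  rw [hc, inv_altEnd_root hij] at h1
  exact hj ⟨y, hy, h₀.symm.loop_of_add_eq (dihedralCoeff_pos (by lia) (by lia) (by lia))
    (dihedralCoeff_nonneg (by lia) (by lia)) h1⟩

theorem line_val {i j : I} (hij : i ≠ j) {n : ℕ} (hm : M i j = n + 1) {c₀ : M.MinRep X}
    (h₀ : IsBottom i j c₀) (hj : ¬ c₀.HasLoop j) {k : ℕ} (hk : k ≤ n) :
    (line c₀ i j k).1 = altEnd (M.simple j) (M.simple i) k * c₀.1 := by
  induction k with
  | zero => simp [line, altEnd]
  | succ k ih =>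
    have h1 := ih (by lia)
    rw [line_succ (not_hasLoop_of_val hij hm hk h₀ hj h1)]
    change M.simple _ * _ = _
    rw [h1, altEnd_succ', letter, mul_assoc]
    split_ifs <;> rfl

theorem not_hasLoop_line {i j : I} (hij : i ≠ j) {n : ℕ} (hm : M i j = n + 1) {c₀ : M.MinRep X}
    (h₀ : IsBottom i j c₀) (hj : ¬ c₀.HasLoop j) {k : ℕ} (hk : k < n) :
    ¬ (line c₀ i j k).HasLoop (letter i j k) :=
  not_hasLoop_of_val hij hm hk h₀ hj (line_val hij hm h₀ hj hk.le)

/-- The path that starts with a loop labelled by `x` also ends with a loop labelled by `x`. -/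
theorem loop_line {i j x : I} (hij : i ≠ j) {n : ℕ} (hm : M i j = n + 1) {c₀ : M.MinRep X}
    (h₀ : IsBottom i j c₀) (hj : ¬ c₀.HasLoop j) (hi : c₀.Loop i x) :
    (line c₀ i j n).Loop (letter i j n) x := by
  have hm1 := M.off_diagonal i j hij
  rw [Loop, ← geomRep_inv_apply_eq_iff, line_val hij hm h₀ hj le_rfl, inv_altEnd_root hij, ← hm,
    dihedralCoeff_self, dihedralCoeff_of_succ_eq (by lia) hm.symm, zero_smul, zero_add, one_smul,
    geomRep_inv_apply_eq_iff]
  exact hi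

theorem Reach.exists_line {i j x : I} (hij : i ≠ j) {n : ℕ} (hm : M i j = n + 1)
    {c₀ c : M.MinRep X} (h₀ : IsBottom i j c₀) (hj : ¬ c₀.HasLoop j) (hx : x ∈ X)
    (hi : c₀.Loop i x) (hr : Reach i j c₀ c) : ∃ k ≤ n, c = line c₀ i j k := by
  induction hr with
  | refl => exact ⟨0, Nat.zero_le _, rfl⟩
  | tail _ h ih =>
    obtain ⟨k, hk, rfl⟩ := ih
    obtain ⟨l, hl, h, rfl⟩ := h
    have hl : l = letter i j k ∨ l = letter i j (k + 1) := by
      simp only [letter, Nat.even_add_one]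
      split_ifs <;> tauto
    rcases hl with rfl | rfl
    · have hkn : k ≠ n := by
        rintro rfl
        exact h ⟨x, hx, loop_line hij hm h₀ hj hi⟩
      exact ⟨k + 1, by lia, (line_succ h).symm⟩
    · cases k with
      | zero => exact absurd ⟨x, hx, by simpa [letter, line] using hi⟩ h
      | succ k =>
        refine ⟨k, by lia, ?_⟩
        have h1 := not_hasLoop_line hij hm h₀ hj (k := k) (by lia)
        simp only [letter_add_two, line_succ h1, move_move]

theorem altEnd_step_of_loop_of_not_hasLoop {i j : I} {x : X} (hij : i ≠ j) (hm : M i j ≠ 0)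
    {c₀ c : M.MinRep X} (h₀ : IsBottom i j c₀) (hj : ¬ c₀.HasLoop j)
    (hi : c₀.Loop i x) (hr : Reach i j c₀ c) (a : A) :
    altEnd (step σ i) (step σ j) (M i j) (c, a) = altEnd (step σ j) (step σ i) (M i j) (c, a) := by
  obtain ⟨n, hn⟩ : ∃ n, M i j = n + 1 := ⟨M i j - 1, by lia⟩
  obtain ⟨k, hk, rfl⟩ := hr.exists_line hij hn h₀ hj x.2 hi
  rw [hn]
  refine (altEnd_line (f := fun k => step σ (letter i j k)) (c := line c₀ i j) (t := σ x)
    (n := n) (fun k => by rw [letter_add_two]) (fun k hk a => ?_) (fun k hk a => ?_) (fun a => ?_)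
    (fun a => ?_) (k := k) (d := n - k) (by lia) a).symm
  · have h := not_hasLoop_line hij hn h₀ hj hk
    rw [line_succ h, step_of_not_hasLoop σ h]
  · have h := not_hasLoop_line hij hn h₀ hj hk
    rw [line_succ h, step_of_not_hasLoop σ (not_hasLoop_move _ _ h), move_move]
  · exact step_of_loop σ x hi a
  · exact step_of_loop σ x (loop_line hij hn h₀ hj hi) a

theorem Reach.symm {i j : I} {c₀ c : M.MinRep X} (hr : Reach i j c₀ c) : Reach j i c₀ c :=
  Relation.ReflTransGen.mono (fun _ _ ⟨l, hl, h⟩ => ⟨l, hl.symm, h⟩) _ _ hr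

/-- The braid relations hold for the action of the generators, provided that they hold for the
elements `σₓ`. The orbit of a coset under `sᵢ` and `sⱼ` is free, a path or a point, according to the
number of loops at its bottom. -/
theorem altProd_step_comm
    (hσ : ∀ x y : X, M x y ≠ 0 → altProd (σ x) (σ y) (M x y) = altProd (σ y) (σ x) (M x y))
    {i j : I} (hij : i ≠ j) (hm : M i j ≠ 0) :
    altProd (step (M := M) σ i) (step σ j) (M i j) =
      altProd (step σ j) (step σ i) (M i j) := by
  rw [← altEnd_comm_iff]
  ext1 ⟨c, a⟩
  obtain ⟨c₀, h₀, hr⟩ := exists_bottom i j c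
  by_cases hi : c₀.HasLoop i
  · obtain ⟨x, hx, hix⟩ := hi
    by_cases hj : c₀.HasLoop j
    · obtain ⟨y, hy, hjy⟩ := hj
      have hc : c = c₀ := by
        clear a
        induction hr with
        | refl => rfl
        | tail _ h ih =>
          obtain ⟨l, hl, h, rfl⟩ := h
          subst ih
          rcases hl with rfl | rfl
          · exact absurd ⟨x, hx, hix⟩ h
          · exact absurd ⟨y, hy, hjy⟩ h
      subst hc
      lift x to X using hx
      lift y to X using hy
      have hxy := hix.label_eq hjy
      rw [altEnd_step_of_loop σ hix hjy, altEnd_step_of_loop σ hjy hix, ← hxy,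
        (altEnd_comm_iff _ _ _).2 (hσ x y (hxy ▸ hm))]
    · exact altEnd_step_of_loop_of_not_hasLoop σ (x := ⟨x, hx⟩) hij hm h₀ hj hix hr a
  · by_cases hj : c₀.HasLoop j
    · obtain ⟨y, hy, hjy⟩ := hj
      rw [M.symmetric i j] at hm ⊢
      exact (altEnd_step_of_loop_of_not_hasLoop σ (x := ⟨y, hy⟩) hij.symm hm h₀.symm hi hjy
        hr.symm a).symm
    · obtain ⟨h1, h2, -⟩ := altEnd_step_of_not_hasLoop σ hr
        (fun c hc l hl => hc.not_hasLoop hij h₀ hi hj hl) (M i j) a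
      obtain ⟨h3, h4, -⟩ := altEnd_step_of_not_hasLoop σ hr.symm
        (fun c hc l hl => hc.symm.not_hasLoop hij h₀ hi hj hl.symm) (M i j) a
      refine Prod.ext (Subtype.ext ?_) (h2.trans h4.symm)
      rw [h1, h3, altEnd_simple_comm]

end MinRep

end CoxeterMatrix

/-! ### The Coxeter matrix of a labelled graph -/

namespace LabelledGraph

variable {I : Type*} (Γ : LabelledGraph I)

open Classical in
/-- The Coxeter matrix of a labelled graph, where the entry `0` stands for a missing edge. -/
noncomputable def coxeterMatrix : CoxeterMatrix I where
  M := Matrix.of fun i j => if i = j then 1 else if h : Γ.graph.Adj i j then Γ.m h else 0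
  isSymm := by
    ext i j
    simp only [Matrix.transpose_apply, Matrix.of_apply, Γ.graph.adj_comm j i, eq_comm (a := j)]
    split_ifs
    · rfl
    · simp only [m, Sym2.eq_swap (a := j)]
    · rfl
  diagonal i := by simp
  off_diagonal i j h := by
    simp only [Matrix.of_apply, h, if_false]
    split_ifs with h'
    · exact fun e => absurd (Γ.two_le_label ⟨s(i, j), h'⟩) (by rw [m] at e; lia)
    · simp

theorem coxeterMatrix_of_adj {i j : I} (h : Γ.graph.Adj i j) : Γ.coxeterMatrix i j = Γ.m h := by
  change (Matrix.of _) i j = _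
  simp [h, h.ne]

theorem adj_of_coxeterMatrix_ne_zero {i j : I} (hij : i ≠ j) (h : Γ.coxeterMatrix i j ≠ 0) :
    Γ.graph.Adj i j := by
  by_contra h'
  apply h
  change (Matrix.of _) i j = _
  simp [h', hij]

end LabelledGraph

/-! ### The retraction onto a standard parabolic subgroup -/

namespace ArtinTits

open CoxeterMatrix

variable {I : Type*} (Γ : LabelledGraph I) (X : Set I)

/-- The set on which the Artin-Tits group acts: the pairs of a coset of `W_X` in the Coxeter group,
given by its minimal representative, and an element of `A_X`. -/
abbrev State : Type _ := Γ.coxeterMatrix.MinRep X × ArtinGroup (Γ.full X)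

/-- The action of `A_I` on the pairs of a coset of `W_X` and an element of `A_X`. -/
noncomputable def action : ArtinGroup Γ →* Equiv.Perm (State Γ X) :=
  PresentedGroup.toGroup (f := MinRep.step (sigma (Γ.full X))) (by
    rintro _ ⟨i, j, h, rfl⟩
    rw [map_mul, map_inv, mul_inv_eq_one, map_altProd, map_altProd, FreeGroup.lift_apply_of,
      FreeGroup.lift_apply_of, ← Γ.coxeterMatrix_of_adj h]
    have hm := Γ.two_le_label ⟨s(i, j), h⟩
    refine MinRep.altProd_step_comm _ (fun x y hxy => ?_) h.ne ?_
    · rcases eq_or_ne x y with rfl | hne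
      · rfl
      have hadj := Γ.adj_of_coxeterMatrix_ne_zero (Subtype.coe_ne_coe.2 hne) hxy
      rw [Γ.coxeterMatrix_of_adj hadj]
      exact sigma_braid (Γ.full X) (i := x) (j := y) hadj
    · rw [Γ.coxeterMatrix_of_adj h, LabelledGraph.m]
      lia)

theorem action_sigma (i : I) : action Γ X (sigma Γ i) = MinRep.step (sigma (Γ.full X)) i :=
  PresentedGroup.toGroup.of _

theorem inclusion_sigma (x : X) : inclusion Γ X (sigma (Γ.full X) x) = sigma Γ x :=
  PresentedGroup.toGroup.of _

theorem wordVal_nil : wordVal Γ [] = 1 := rfl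

theorem wordVal_cons (p : I × Bool) (w : SignedWord I) :
    wordVal Γ (p :: w) = (if p.2 then sigma Γ p.1 else (sigma Γ p.1)⁻¹) * wordVal Γ w := by
  simp [wordVal]

theorem inclusion_wordVal (w : SignedWord X) :
    inclusion Γ X (wordVal (Γ.full X) w) = wordVal Γ w.incl := by
  induction w with
  | nil => simp [wordVal_nil, SignedWord.incl]
  | cons p w ih =>
    rw [SignedWord.incl, List.map_cons, wordVal_cons, wordVal_cons, map_mul, ih]
    congr 1
    split_ifs <;> simp [inclusion_sigma]

theorem wordVal_surjective : Function.Surjective (wordVal Γ) := by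
  intro g
  have hg : g ∈ Subgroup.closure (Set.range (sigma Γ)) := by
    have : Subgroup.closure (Set.range (sigma Γ)) = ⊤ := PresentedGroup.closure_range_of _
    rw [this]
    trivial
  induction hg using Subgroup.closure_induction_left with
  | one => exact ⟨[], rfl⟩
  | mul_left x hx y hy ih =>
    obtain ⟨i, rfl⟩ := hx
    obtain ⟨w, rfl⟩ := ih
    exact ⟨(i, true) :: w, by simp [wordVal_cons]⟩
  | inv_mul_cancel x hx y hy ih =>
    obtain ⟨i, rfl⟩ := hx
    obtain ⟨w, rfl⟩ := ih
    exact ⟨(i, false) :: w, by simp [wordVal_cons]⟩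

/-- The set-theoretic retraction of `A_I` onto `A_X`: the second component of the image under the
action of the base point. -/
noncomputable def retraction (g : ArtinGroup Γ) : ArtinGroup (Γ.full X) :=
  (action Γ X g (MinRep.base X, 1)).2

theorem action_inclusion (h a : ArtinGroup (Γ.full X)) :
    action Γ X (inclusion Γ X h) (MinRep.base X, a) = (MinRep.base X, h * a) := by
  obtain ⟨w, rfl⟩ := wordVal_surjective (Γ.full X) h
  induction w with
  | nil => simp [wordVal_nil]
  | cons p w ih =>
    have hs (b : ArtinGroup (Γ.full X)) : action Γ X (sigma Γ p.1) (MinRep.base X, b) =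
        (MinRep.base X, sigma (Γ.full X) p.1 * b) := by
      rw [action_sigma, MinRep.step_of_loop _ p.1 (MinRep.loop_base _)]
    rw [wordVal_cons, map_mul, map_mul, Equiv.Perm.mul_apply, ih, mul_assoc]
    split_ifs
    · rw [inclusion_sigma, hs]
    · rw [map_inv, inclusion_sigma, map_inv, Equiv.Perm.inv_eq_iff_eq, hs, mul_inv_cancel_left]

theorem retraction_inclusion (h : ArtinGroup (Γ.full X)) :
    retraction Γ X (inclusion Γ X h) = h := by
  rw [retraction, action_inclusion, mul_one]

theorem inclusion_injective : Function.Injective (inclusion Γ X) :=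
  Function.LeftInverse.injective (retraction_inclusion Γ X)

theorem retraction_mem_positive {g : ArtinGroup Γ} (hg : g ∈ positive Γ) :
    retraction Γ X g ∈ positive (Γ.full X) := by
  rw [positive] at hg
  rw [retraction]
  induction hg using Submonoid.closure_induction_left with
  | one => simp [one_mem]
  | mul_left x hx y hy ih =>
    obtain ⟨i, rfl⟩ := hx
    rw [map_mul, Equiv.Perm.mul_apply, action_sigma]
    generalize action Γ X y (MinRep.base X, 1) = p at ih
    obtain ⟨c, a⟩ := p
    by_cases h : c.HasLoop i
    · obtain ⟨x, hx, h⟩ := h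
      rw [MinRep.step_of_loop _ ⟨x, hx⟩ h]
      exact mul_mem (Submonoid.subset_closure ⟨_, rfl⟩) ih
    · rwa [MinRep.step_of_not_hasLoop _ h]

/-- The retraction does not increase the length of words, and decreases it for words with a letter
outside of `X`. -/
theorem exists_word_retraction (w : SignedWord I) :
    ∃ v : SignedWord X, wordVal (Γ.full X) v = retraction Γ X (wordVal Γ w) ∧
      (v.length < w.length ∨ v.length = w.length ∧ (∀ p ∈ w, p.1 ∈ X) ∧
        (action Γ X (wordVal Γ w) (MinRep.base X, 1)).1 = MinRep.base X) := by
  induction w with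
  | nil => exact ⟨[], by simp [wordVal_nil, retraction]⟩
  | cons p w ih =>
    obtain ⟨v, hv, ih⟩ := ih
    obtain ⟨i, b⟩ := p
    rw [retraction] at hv ⊢
    rw [wordVal_cons, map_mul, Equiv.Perm.mul_apply]
    generalize action Γ X (wordVal Γ w) (MinRep.base X, 1) = q at hv ih
    obtain ⟨c, a⟩ := q
    dsimp only at hv ih
    subst hv
    by_cases h : c.HasLoop i
    · obtain ⟨x, hx, h⟩ := h
      have hs : action Γ X (if b then sigma Γ i else (sigma Γ i)⁻¹) (c, wordVal (Γ.full X) v) =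
          (c, wordVal (Γ.full X) ((⟨x, hx⟩, b) :: v)) := by
        rw [wordVal_cons]
        cases b
        · simp only [Bool.false_eq_true, if_false]
          rw [map_inv, Equiv.Perm.inv_eq_iff_eq, action_sigma, MinRep.step_of_loop _ ⟨x, hx⟩ h,
            mul_inv_cancel_left]
        · simp only [if_true]
          rw [action_sigma, MinRep.step_of_loop _ ⟨x, hx⟩ h]
      refine ⟨(⟨x, hx⟩, b) :: v, by rw [hs], ?_⟩
      rw [hs]
      rcases ih with ih | ⟨ih1, ih2, rfl⟩
      · left
        simpa using ih
      · right
        refine ⟨by simpa using ih1, ?_, rfl⟩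
        have hi : i ∈ X := (MinRep.hasLoop_base_iff i).1 ⟨x, hx, h⟩
        simpa [hi] using ih2
    · have hs : action Γ X (if b then sigma Γ i else (sigma Γ i)⁻¹) (c, wordVal (Γ.full X) v) =
          (c.move i h, wordVal (Γ.full X) v) := by
        cases b
        · simp only [Bool.false_eq_true, if_false]
          rw [map_inv, Equiv.Perm.inv_eq_iff_eq, action_sigma,
            MinRep.step_of_not_hasLoop _ (c.not_hasLoop_move i h), MinRep.move_move]
        · simp only [if_true]
          rw [action_sigma, MinRep.step_of_not_hasLoop _ h]
      refine ⟨v, by rw [hs], Or.inl ?_⟩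
      rw [List.length_cons]
      lia

/-- The retraction turns a word for an element of `A_X` into a word on `X` for the same element,
which is strictly shorter if a letter was outside of `X`. -/
theorem mem_of_minimal_length {w : SignedWord I} (hw : wordVal Γ w ∈ (inclusion Γ X).range)
    (hmin : ∀ v : SignedWord I, wordVal Γ v = wordVal Γ w → w.length ≤ v.length) :
    ∀ p ∈ w, p.1 ∈ X := by
  obtain ⟨h, hh⟩ := hw
  obtain ⟨v, hv, hlen⟩ := exists_word_retraction Γ X w
  rw [← hh, retraction_inclusion] at hv
  have h1 := hmin v.incl (by rw [← inclusion_wordVal, hv, hh])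
  rw [SignedWord.incl, List.length_map] at h1
  rcases hlen with hlen | ⟨-, hlen, -⟩
  · lia
  · exact hlen

/-! ### Intersections, positive elements and words of minimal length -/

theorem wordVal_mem_range {w : SignedWord I} (hw : ∀ p ∈ w, p.1 ∈ X) :
    wordVal Γ w ∈ (inclusion Γ X).range := by
  induction w with
  | nil => exact one_mem _
  | cons p w ih =>
    rw [List.forall_mem_cons] at hw
    have hp : sigma Γ p.1 ∈ (inclusion Γ X).range :=
      ⟨sigma (Γ.full X) ⟨p.1, hw.1⟩, inclusion_sigma Γ X _⟩
    rw [wordVal_cons]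
    refine mul_mem ?_ (ih hw.2)
    split_ifs
    · exact hp
    · exact inv_mem hp

theorem range_inclusion_mono {X Y : Set I} (h : X ⊆ Y) :
    (inclusion Γ X).range ≤ (inclusion Γ Y).range := by
  rintro _ ⟨g, rfl⟩
  obtain ⟨w, rfl⟩ := wordVal_surjective (Γ.full X) g
  rw [inclusion_wordVal]
  apply wordVal_mem_range
  simp only [SignedWord.incl, List.mem_map]
  rintro _ ⟨q, -, rfl⟩
  exact h q.1.2

theorem exists_minimal_word (g : ArtinGroup Γ) : ∃ w, wordVal Γ w = g ∧
    ∀ v, wordVal Γ v = wordVal Γ w → w.length ≤ v.length := by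
  obtain ⟨w, hw, hmin⟩ := exists_minimalFor_of_wellFoundedLT (fun w => wordVal Γ w = g) List.length
    (wordVal_surjective Γ g)
  refine ⟨w, hw, fun v hv => ?_⟩
  by_contra! h
  exact absurd (hmin (hv.trans hw) h.le) (by lia)

theorem range_inclusion_inf (Y : Set I) :
    (inclusion Γ X).range ⊓ (inclusion Γ Y).range = (inclusion Γ (X ∩ Y)).range := by
  apply le_antisymm
  · rintro g ⟨hX, hY⟩
    obtain ⟨w, rfl, hmin⟩ := exists_minimal_word Γ g
    exact wordVal_mem_range Γ _ fun p hp =>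
      ⟨mem_of_minimal_length Γ X hX hmin p hp, mem_of_minimal_length Γ Y hY hmin p hp⟩
  · exact le_inf (range_inclusion_mono Γ Set.inter_subset_left)
      (range_inclusion_mono Γ Set.inter_subset_right)

theorem map_positive : (positive (Γ.full X)).map (inclusion Γ X) =
    positive Γ ⊓ (inclusion Γ X).range.toSubmonoid := by
  apply le_antisymm
  · refine le_inf ?_ ?_
    · rw [positive, MonoidHom.map_mclosure, Submonoid.closure_le]
      rintro _ ⟨_, ⟨x, rfl⟩, rfl⟩
      rw [inclusion_sigma]
      exact Submonoid.subset_closure ⟨_, rfl⟩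
    · rintro _ ⟨g, -, rfl⟩
      exact ⟨g, rfl⟩
  · rintro _ ⟨hpos, g, rfl⟩
    refine ⟨g, ?_, rfl⟩
    have := retraction_mem_positive Γ X hpos
    rwa [retraction_inclusion] at this

end ArtinTits

theorem proposition2 {I : Type*} [Finite I] (Γ : LabelledGraph I) (X : Set I) :
    -- (i) equivalence of words on `Σ_X ∪ Σ_X⁻¹` in `A_I` implies equivalence in `A_X`,
    -- and `ι_X` is injective
    ((∀ w w' : ArtinTits.SignedWord X,
        ArtinTits.wordVal Γ w.incl = ArtinTits.wordVal Γ w'.incl →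
          ArtinTits.wordVal (Γ.full X) w = ArtinTits.wordVal (Γ.full X) w') ∧
      Function.Injective (ArtinTits.inclusion Γ X)) ∧
    -- (ii) `A_X ∩ A_Y = A_{X ∩ Y}` in `A_I`
    (∀ Y : Set I,
      (ArtinTits.inclusion Γ X).range ⊓ (ArtinTits.inclusion Γ Y).range =
        (ArtinTits.inclusion Γ (X ∩ Y)).range) ∧
    -- (iii) `A_X⁺ = A_I⁺ ∩ A_X`
    (ArtinTits.positive (Γ.full X)).map (ArtinTits.inclusion Γ X) =
      ArtinTits.positive Γ ⊓ (ArtinTits.inclusion Γ X).range.toSubmonoid ∧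
    -- (iv) `A_X` is convex
    (∀ w : ArtinTits.SignedWord I,
      ArtinTits.wordVal Γ w ∈ (ArtinTits.inclusion Γ X).range →
      (∀ v : ArtinTits.SignedWord I,
        ArtinTits.wordVal Γ v = ArtinTits.wordVal Γ w → w.length ≤ v.length) →
      ∀ p ∈ w, p.1 ∈ X) := by
  refine ⟨⟨fun w w' h => ?_, ArtinTits.inclusion_injective Γ X⟩,
    ArtinTits.range_inclusion_inf Γ X, ArtinTits.map_positive Γ X,
    fun w => ArtinTits.mem_of_minimal_length Γ X⟩
  rw [← ArtinTits.inclusion_wordVal, ← ArtinTits.inclusion_wordVal] at h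
  exact ArtinTits.inclusion_injective Γ X h
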